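/- Let $k\ge 2$. All DFAs are complete. The state complexity $\mathrm{sc}(L)$ of a regular language $L$ is the least number of states of a DFA accepting $L$. For positive integers $n_1,\dots,n_k$ and $f_1,\dots,f_k$ with $0<f_i<n_i$ put, for lists of positive integers, $T()=1$ and $T(m_1,\dots,m_r)=1+(2^{m_1}-1)\,T(m_2,\dots,m_r)$, so that $$T(m_1,\dots,m_r)=1+(2^{m_1}-1)\bigl(1+(2^{m_2}-1)\bigl(\cdots\bigl(1+(2^{m_{r-1}}-1)2^{m_r}\bigr)\cdots\bigr)\bigr),$$ and define $$D=\sum_{t=2}^{k-1} n_1\Bigl(\prod_{j=2}^{t-1}(2^{n_j}-1)\Bigr)\bigl(2^{n_{t+1}+\cdots+n_k}-1\bigr),$$ $$E_i=\Bigl(\sum_{\{i\}\subseteq S\subseteq\{1,\dots,i\}} e_S\prod_{j=2}^{i} c_{S,j}\Bigr)\bigl(1+(2^{n_{i+1}-1}-1)\,T(n_{i+2},\dots,n_k)\bigr)\qquad(1\le i\le k-1),$$ where $e_S=f_1$ if $1\in S$, $e_S=n_1-f_1$ if $1\notin S$, and $$c_{S,j}=\begin{cases}(2^{f_j}-1)2^{n_j-f_j-1}&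 j\in S,\ j-1\in S,\\ (2^{f_j}-1)2^{n_j-f_j}& j\in S,\ j-1\notin S,\\ 2^{n_j-f_j-1}& j\notin S,\ j-1\in S,\\ 2^{n_j-f_j}-1& j\notin S,\ j-1\notin S.\end{cases}$$ Let $N(n_1,\dots,n_k;f_1,\dots,f_k)=n_1 2^{n_2+\cdots+n_k}-D-\sum_{i=1}^{k-1}E_i$. **Theorem.** 1. (Upper bound.) If $A_1,\dots,A_k$ are DFAs over a common alphabet such that $A_i$ has $n_i$ states and $f_i$ final states, $0<f_i<n_i$, then there is a DFA with exactly $N(n_1,\dots,n_k;f_1,\dots,f_k)$ states (not necessarily all reachable) that accepts $L(A_1)L(A_2)\cdots L(A_k)$. 2. (Matching lower bound.) For all $n_1,\dots,n_k\ge 2$ there are a finite nonempty alphabet and DFAs $A_i$ over it with $n_i$ states and one final state each such that every DFA accepting $L(A_1)\cdots L(A_k)$ has at least $N(n_1,\dots,n_k;1,\dots,1)$ states. 3. (Exact state complexity.) Consequently, for all $n_1,\dots,n_k\ge 2$, $N(n_1,\dots,n_k;1,\dots,1)$ is the maximum of $\mathrm{sc}(L_1\cdots L_k)$ over all finite nonempty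 alphabets and all languages $L_i$ over them accepted by DFAs with $n_i$ states, and also its maximum over all languages $L_i$ with $\mathrm{sc}(L_i)=n_i$. -/

import Mathlib

/-- The catenation `L₁ L₂ ⋯ L_k` of a family of `k` languages, in this order. -/
def catenation {α : Type*} {k : ℕ} (L : Fin k → Language α) : Language α :=
  (List.ofFn L).prod

/-- `L` is accepted by a (complete) deterministic finite automaton with exactly `m` states. -/
def HasDFA {α : Type*} (L : Language α) (m : ℕ) : Prop :=
  ∃ (τ : Type) (_ : Fintype τ) (M : DFA α τ), Fintype.card τ = m ∧ M.accepts = L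

/-- The state complexity of a regular language: the number of states of a smallest complete DFA
accepting it (every DFA has at least one state, so the value is `0` exactly when `L` is not
regular). -/
noncomputable def stateComplexity {α : Type*} (L : Language α) : ℕ :=
  sInf {m | HasDFA L m}

/-! In the following, `n i` and `f i` (for `1 ≤ i ≤ k`) are the number of states and the number of
final states of the `i`-th automaton; the values at other indices are not used. -/

/-- For the list `m₁, …, m_r`, the nested expression
`1 + (2^m₁ - 1)(1 + (2^m₂ - 1)(⋯ (1 + (2^m_{r-1} - 1) 2^m_r) ⋯))`, which is `1` if `r = 0` and
`2^m₁ = 1 + (2^m₁ - 1) * 1` if `r = 1`. -/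
def nested : List ℕ → ℤ
  | [] => 1
  | m :: l => 1 + (2 ^ m - 1) * nested l

/-- `D = ∑_{t=2}^{k-1} n₁ (2^{n₂} - 1) ⋯ (2^{n_{t-1}} - 1) (2^{n_{t+1} + ⋯ + n_k} - 1)`. -/
def termD (k : ℕ) (n : ℕ → ℕ) : ℤ :=
  ∑ t ∈ Finset.Icc 2 (k - 1),
    (n 1 : ℤ) * (∏ j ∈ Finset.Ico 2 t, ((2 : ℤ) ^ n j - 1)) *
      (2 ^ (∑ j ∈ Finset.Icc (t + 1) k, n j) - 1)

/-- One of the four factors that the index `j ≥ 2` contributes to a summand of `E_i`; it depends on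
whether `j` and `j - 1` belong to `S`. -/
def factorE (n f : ℕ → ℕ) (S : Finset ℕ) (j : ℕ) : ℤ :=
  if j ∈ S then
    if j - 1 ∈ S then (2 ^ f j - 1) * 2 ^ (n j - f j - 1) else (2 ^ f j - 1) * 2 ^ (n j - f j)
  else
    if j - 1 ∈ S then 2 ^ (n j - f j - 1) else 2 ^ (n j - f j) - 1

/-- `E_i`, a sum of `2^{i-1}` products (one for each set `S` with `i ∈ S ⊆ {1, …, i}`), from
`(n₁ - f₁) (2^{n₂-f₂} - 1) ⋯ (2^{n_{i-1}-f_{i-1}} - 1) · (2^{f_i} - 1) 2^{n_i-f_i}` to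
`f₁ · (2^{f₂} - 1) 2^{n₂-f₂-1} ⋯ (2^{f_i} - 1) 2^{n_i-f_i-1}`, all multiplied by
`1 + (2^{n_{i+1}-1} - 1)(1 + (2^{n_{i+2}} - 1)(⋯ (1 + (2^{n_{k-1}} - 1) 2^{n_k}) ⋯))`. -/
def termE (k : ℕ) (n f : ℕ → ℕ) (i : ℕ) : ℤ :=
  ∑ S ∈ (Finset.Icc 1 (i - 1)).powerset,
    (if 1 ∈ insert i S then (f 1 : ℤ) else (n 1 : ℤ) - f 1) *
      (∏ j ∈ Finset.Icc 2 i, factorE n f (insert i S) j) *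
      (1 + (2 ^ (n (i + 1) - 1) - 1) * nested ((List.Ico (i + 2) (k + 1)).map n))

/-- `n₁ 2^{n₂ + ⋯ + n_k} - D - ∑_{i=1}^{k-1} E_i`. -/
def catBound (k : ℕ) (n f : ℕ → ℕ) : ℤ :=
  (n 1 : ℤ) * 2 ^ (∑ j ∈ Finset.Icc 2 k, n j) - termD k n -
    ∑ i ∈ Finset.Icc 1 (k - 1), termE k n f i

/-! After a word `w`, record for each `i` the set `X_i` of states in which `A_i` can be when it is
started after a prefix of `w` lying in the catenation of the preceding languages. This tuple
determines its own successors and membership in the catenation. It is always valid: `X_1` is a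
singleton, a final state in `X_i` puts the initial state into `X_{i+1}`, and nothing nonempty
follows an empty set (`track_valid`).

Valid tuples are counted from left to right. All that matters about `X_i` is whether it meets the
final states, misses them while nonempty, or is empty; this gives the recursion `tailCount`. The
recursion is exact when no initial state is final. In general it is an upper bound, because a set
that meets the final states leaves at most as many continuations as a nonempty one that misses them,
and making an initial state final, or adding final states, only trades misses for hits
(`card_linked_le`). The closed formula is the same count by exclusion: `D` removes tuples with a
nonempty set somewhere after an empty one, and `E_i` removes those whose first missing initial state
is at index `i + 1` (`catBound_eq`).

For the lower bound, the letters are all tuples of transformations, and `A_i` has initial state `s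
i` and a different, single final state `t i`. Different tuples are distinguished by passing a
difference on to the next automaton until the last one is reached (`exists_distinguishing_word`).
Every valid tuple is reached by induction on the total size of its sets (`exists_track_eq`). -/

/-- The number of ways in which a valid tuple of sets can be continued at the indices
`j, …, j + r - 1`, if the preceding set contains a final state (`true`), or is nonempty and
contains no final state (`false`). -/
def tailCount (n f : ℕ → ℕ) : ℕ → ℕ → Bool → ℤ
  | 0, _, _ => 1
  | r + 1, j, true =>
      (2 ^ (n j - 1) - 2 ^ (n j - f j - 1)) * tailCount n f r (j + 1) true +
        2 ^ (n j - f j - 1) * tailCount n f r (j + 1) false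
  | r + 1, j, false =>
      1 + (2 ^ n j - 2 ^ (n j - f j)) * tailCount n f r (j + 1) true +
        (2 ^ (n j - f j) - 1) * tailCount n f r (j + 1) false

theorem two_pow_pred {m : ℕ} (h : 0 < m) : (2 : ℤ) ^ m = 2 * 2 ^ (m - 1) := by
  obtain ⟨m, rfl⟩ := Nat.exists_eq_succ_of_ne_zero h.ne'
  simp [pow_succ, mul_comm]

/-- A hit forces the next set to contain the initial state, whereas a nonempty miss leaves it free,
so the latter has at least as many continuations. This monotonicity is what later allows misses to
be traded for hits in the upper bound. -/
theorem tailCount_bounds (n f : ℕ → ℕ) (r : ℕ) : ∀ j : ℕ, (∀ i < r, f (j + i) < n (j + i)) →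
    1 ≤ tailCount n f r j true ∧ tailCount n f r j true ≤ tailCount n f r j false := by
  induction r with
  | zero => intro j _; simp [tailCount]
  | succ r ih =>
    intro j h
    obtain ⟨h1, h2⟩ := ih (j + 1) fun i hi => by
      have := h (i + 1) (by omega)
      rwa [show j + (i + 1) = j + 1 + i by ring] at this
    have h0 := h 0 (by omega)
    simp only [add_zero] at h0
    have e1 := two_pow_pred (m := n j) (by omega)
    have e2 := two_pow_pred (m := n j - f j) (by omega)
    have e3 : (2 : ℤ) ^ (n j - f j - 1) ≤ 2 ^ (n j - 1) :=
      pow_le_pow_right₀ (by norm_num) (by omega)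
    have e4 : (1 : ℤ) ≤ 2 ^ (n j - f j - 1) := one_le_pow₀ (by norm_num)
    simp only [tailCount, e1, e2]
    generalize (2 : ℤ) ^ (n j - f j - 1) = x at *
    generalize (2 : ℤ) ^ (n j - 1) = y at *
    generalize tailCount n f r (j + 1) true = a at *
    generalize tailCount n f r (j + 1) false = b at *
    constructor
    · nlinarith [mul_nonneg (sub_nonneg.2 e3) (by linarith : (0 : ℤ) ≤ a)]
    · nlinarith [mul_nonneg (sub_nonneg.2 e3) (by linarith : (0 : ℤ) ≤ a),
        mul_nonneg (sub_nonneg.2 e4) (by linarith : (0 : ℤ) ≤ b)]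

/-! ### The closed formula -/

/-- Both sides count the tuples of arbitrary sets in which some nonempty set follows an empty one.
On the right they are sorted by the index `t` of the first empty set: the earlier sets are nonempty
and the later ones not all empty. -/
theorem pow_sum_sub_nested (n : ℕ → ℕ) (k r : ℕ) : ∀ j, j + r = k + 1 →
    (2 : ℤ) ^ (∑ i ∈ Finset.Icc j k, n i) - nested ((List.Ico j (k + 1)).map n) =
      ∑ t ∈ Finset.Ico j k, (∏ i ∈ Finset.Ico j t, ((2 : ℤ) ^ n i - 1)) *
        (2 ^ (∑ i ∈ Finset.Icc (t + 1) k, n i) - 1) := by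
  induction r with
  | zero =>
    intro j hj
    obtain rfl : j = k + 1 := hj
    simp [nested]
  | succ r ih =>
    intro j hj
    rw [List.Ico.eq_cons (by omega), List.map_cons, nested,
      ← Finset.add_sum_Ioc_eq_sum_Icc (by omega : j ≤ k), ← Finset.Icc_add_one_left_eq_Ioc, pow_add]
    have := ih (j + 1) (by omega)
    by_cases hjk : j = k
    · subst hjk
      simp [nested]
    rw [Finset.sum_eq_sum_Ico_succ_bot (by omega : j < k)]
    have e : ∑ t ∈ Finset.Ico (j + 1) k, (∏ i ∈ Finset.Ico j t, ((2 : ℤ) ^ n i - 1)) *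
        (2 ^ (∑ i ∈ Finset.Icc (t + 1) k, n i) - 1) = (2 ^ n j - 1) *
        ∑ t ∈ Finset.Ico (j + 1) k, (∏ i ∈ Finset.Ico (j + 1) t, ((2 : ℤ) ^ n i - 1)) *
        (2 ^ (∑ i ∈ Finset.Icc (t + 1) k, n i) - 1) := by
      rw [Finset.mul_sum]
      refine Finset.sum_congr rfl fun t ht => ?_
      rw [Finset.prod_eq_prod_Ico_succ_bot (by simp at ht; omega : j < t), mul_assoc]
    rw [e, ← this]
    simp only [Finset.Ico_self, Finset.prod_empty]
    ring

theorem pow_sum_sub_termD (n : ℕ → ℕ) (k : ℕ) (hk : 1 ≤ k) :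
    (n 1 : ℤ) * 2 ^ (∑ j ∈ Finset.Icc 2 k, n j) - termD k n =
      n 1 * nested ((List.Ico 2 (k + 1)).map n) := by
  have h := pow_sum_sub_nested n k (k - 1) 2 (by omega)
  have e : termD k n = n 1 * ∑ t ∈ Finset.Ico 2 k, (∏ i ∈ Finset.Ico 2 t, ((2 : ℤ) ^ n i - 1)) *
        (2 ^ (∑ i ∈ Finset.Icc (t + 1) k, n i) - 1) := by
    rw [termD, Finset.mul_sum]
    refine Finset.sum_congr ?_ fun t _ => by rw [mul_assoc]
    ext t; simp; omega
  rw [e, ← h]; ring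

/-- The summand of `termE` for the set `S`, without the last factor. -/
def prefixWeight (n f : ℕ → ℕ) (i : ℕ) (S : Finset ℕ) : ℤ :=
  (if 1 ∈ S then (f 1 : ℤ) else (n 1 : ℤ) - f 1) * ∏ j ∈ Finset.Icc 2 i, factorE n f S j

/-- The number of initial parts `X₁, …, X_i` without violation where `X_i` contains a final state. -/
def hitSum (n f : ℕ → ℕ) (i : ℕ) : ℤ :=
  ∑ S ∈ (Finset.Icc 1 (i - 1)).powerset, prefixWeight n f i (insert i S)

/-- The number of initial parts `X₁, …, X_i` without violation where `X_i` is nonempty and contains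
no final state. -/
def missSum (n f : ℕ → ℕ) (i : ℕ) : ℤ :=
  ∑ S ∈ (Finset.Icc 1 (i - 1)).powerset, prefixWeight n f i S

theorem termE_eq (k : ℕ) (n f : ℕ → ℕ) (i : ℕ) : termE k n f i = hitSum n f i *
    (1 + (2 ^ (n (i + 1) - 1) - 1) * nested ((List.Ico (i + 2) (k + 1)).map n)) := by
  rw [termE, hitSum, Finset.sum_mul]
  rfl

theorem prefixWeight_succ (n f : ℕ → ℕ) {i : ℕ} (hi : 1 ≤ i) (S : Finset ℕ) :
    prefixWeight n f (i + 1) S = prefixWeight n f i S * factorE n f S (i + 1) := by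
  rw [prefixWeight, prefixWeight, Finset.prod_Icc_succ_top (by omega), mul_assoc]

theorem prefixWeight_insert_succ (n f : ℕ → ℕ) {i : ℕ} (hi : 1 ≤ i) (S : Finset ℕ) :
    prefixWeight n f i (insert (i + 1) S) = prefixWeight n f i S := by
  have e : (1 ∈ insert (i + 1) S) = (1 ∈ S) := by simp; omega
  simp only [prefixWeight, e]
  congr 1
  refine Finset.prod_congr rfl fun j hj => ?_
  rw [Finset.mem_Icc] at hj
  have e1 : (j ∈ insert (i + 1) S) = (j ∈ S) := by simp; omega
  have e2 : (j - 1 ∈ insert (i + 1) S) = (j - 1 ∈ S) := by simp; omega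
  simp only [factorE, e1, e2]

theorem sum_powerset_Icc {M : Type*} [AddCommMonoid M] {i : ℕ} (hi : 1 ≤ i) (g : Finset ℕ → M) :
    ∑ S ∈ (Finset.Icc 1 i).powerset, g S = ∑ S ∈ (Finset.Icc 1 (i - 1)).powerset, g S +
      ∑ S ∈ (Finset.Icc 1 (i - 1)).powerset, g (insert i S) := by
  have e : Finset.Icc 1 i = insert i (Finset.Icc 1 (i - 1)) := by ext x; simp; omega
  rw [e, Finset.sum_powerset_insert (by simp; omega)]

/-- Here `S` is the set of indices whose set contains a final state, so splitting by `i ∈ S` turns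
the sum over subsets into one step of a two-state recursion. -/
theorem hitSum_succ (n f : ℕ → ℕ) {i : ℕ} (hi : 1 ≤ i) : hitSum n f (i + 1) =
    hitSum n f i * ((2 ^ f (i + 1) - 1) * 2 ^ (n (i + 1) - f (i + 1) - 1)) +
      missSum n f i * ((2 ^ f (i + 1) - 1) * 2 ^ (n (i + 1) - f (i + 1))) := by
  rw [hitSum, Nat.add_sub_cancel, sum_powerset_Icc hi, add_comm, hitSum, missSum, Finset.sum_mul,
    Finset.sum_mul]
  congr 1 <;> refine Finset.sum_congr rfl fun S hS => ?_ <;>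
    rw [prefixWeight_succ n f hi, prefixWeight_insert_succ n f hi]
  · simp [factorE]
  · have : i ∉ S := fun h => by have := Finset.mem_powerset.1 hS h; simp at this; omega
    simp [factorE, this]

theorem missSum_succ (n f : ℕ → ℕ) {i : ℕ} (hi : 1 ≤ i) : missSum n f (i + 1) =
    hitSum n f i * 2 ^ (n (i + 1) - f (i + 1) - 1) +
      missSum n f i * (2 ^ (n (i + 1) - f (i + 1)) - 1) := by
  rw [missSum, Nat.add_sub_cancel, sum_powerset_Icc hi, add_comm, hitSum, missSum, Finset.sum_mul,
    Finset.sum_mul]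
  congr 1 <;> refine Finset.sum_congr rfl fun S hS => ?_ <;>
    rw [prefixWeight_succ n f hi]
  all_goals
    have h0 : i + 1 ∉ S := fun h => by have := Finset.mem_powerset.1 hS h; simp at this; omega
  · simp [factorE, h0]
  · have : i ∉ S := fun h => by have := Finset.mem_powerset.1 hS h; simp at this; omega
    simp [factorE, this, h0]

/-- `nested` counts continuations that respect only the rule for empty sets, and `tailCount` those
that also respect the rule for initial states. The difference, weighted by violation-free
beginnings, counts tuples whose first violation comes after index `i`; the summand for `t` collects
those where `X_t` has a final state but `X_{t+1}` lacks the initial one. -/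
theorem sum_termE (n f : ℕ → ℕ) (k r : ℕ) : ∀ i, 1 ≤ i → i + r = k →
    (∀ j, i < j → j ≤ k → f j < n j) →
    hitSum n f i * (nested ((List.Ico (i + 1) (k + 1)).map n) - tailCount n f r (i + 1) true) +
      missSum n f i * (nested ((List.Ico (i + 1) (k + 1)).map n) - tailCount n f r (i + 1) false) =
      ∑ t ∈ Finset.Ico i k, termE k n f t := by
  induction r with
  | zero =>
    intro i _ hi _
    obtain rfl : i = k := hi
    simp [nested, tailCount]
  | succ r ih =>
    intro i h1 hi hf
    have := ih (i + 1) (by omega) (by omega) fun j hj => hf j (by omega)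
    rw [Finset.sum_eq_sum_Ico_succ_bot (by omega : i < k), ← this, termE_eq, hitSum_succ n f h1,
      missSum_succ n f h1, List.Ico.eq_cons (by omega : i + 1 < k + 1), List.map_cons, nested]
    have h0 := hf (i + 1) (by omega) (by omega)
    have e1 := two_pow_pred (m := n (i + 1)) (by omega)
    have e2 := two_pow_pred (m := n (i + 1) - f (i + 1)) (by omega)
    have e3 : (2 : ℤ) ^ (n (i + 1) - 1) =
        2 ^ (f (i + 1)) * 2 ^ (n (i + 1) - f (i + 1) - 1) := by
      rw [← pow_add]; congr 1; omega
    simp only [tailCount, e1, e2, e3]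
    ring

theorem catBound_eq (k : ℕ) (n f : ℕ → ℕ) (h : ∀ j, 2 ≤ j → j ≤ k + 1 → f j < n j) :
    catBound (k + 1) n f =
      f 1 * tailCount n f k 2 true + ((n 1 : ℤ) - f 1) * tailCount n f k 2 false := by
  have h1 := sum_termE n f (k + 1) k 1 le_rfl (by omega) fun j hj => h j (by omega)
  have e : Finset.Icc 1 (k + 1 - 1) = Finset.Ico 1 (k + 1) := by ext; simp
  rw [catBound, pow_sum_sub_termD n _ (by omega), e, ← h1]
  simp [hitSum, missSum, prefixWeight]
  ring

/-! ### Counting valid tuples -/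

/-- Consecutive sets are compatible; `h` and `e` say whether a set in front of the first one contains
a final state, and whether it is empty. -/
def Linked {k : ℕ} {Q : Fin k → Type*} (s : ∀ i, Q i) (F : ∀ i, Finset (Q i)) (h e : Prop)
    (X : ∀ i, Finset (Q i)) : Prop :=
  (∀ i : Fin k, (i : ℕ) = 0 → (h → s i ∈ X i) ∧ (e → X i = ∅)) ∧
  ∀ i j : Fin k, (i : ℕ) + 1 = j → (¬ Disjoint (X i) (F i) → s j ∈ X j) ∧ (X i = ∅ → X j = ∅)

theorem linked_succ_iff {k : ℕ} {Q : Fin (k + 1) → Type*} (s : ∀ i, Q i)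
    (F : ∀ i, Finset (Q i)) (h e : Prop) (X : ∀ i, Finset (Q i)) :
    Linked s F h e X ↔ ((h → s 0 ∈ X 0) ∧ (e → X 0 = ∅)) ∧
      Linked (Fin.tail s) (Fin.tail F) (¬ Disjoint (X 0) (F 0)) (X 0 = ∅) (Fin.tail X) := by
  constructor
  · rintro ⟨h1, h2⟩
    refine ⟨h1 0 rfl, fun i hi => h2 0 i.succ ?_, fun i j hij => h2 i.succ j.succ ?_⟩
    · simp [hi]
    · simp [hij]
  · rintro ⟨h1, h2, h3⟩
    refine ⟨fun i hi => ?_, fun i j hij => ?_⟩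
    · obtain rfl : i = 0 := Fin.ext hi
      exact h1
    · obtain ⟨j, rfl⟩ := Fin.exists_succ_eq.2 (show j ≠ 0 by rintro rfl; simp at hij)
      cases i using Fin.cases with
      | zero => exact h2 j (by simpa using hij.symm)
      | succ i => exact h3 i j (by simpa using hij)

/-- A linked tuple is a first set followed by a linked tuple. -/
def linkedEquiv {k : ℕ} {Q : Fin (k + 1) → Type*} (s : ∀ i, Q i)
    (F : ∀ i, Finset (Q i)) (h e : Prop) :
    {X // Linked s F h e X} ≃ (Σ S : {S : Finset (Q 0) // (h → s 0 ∈ S) ∧ (e → S = ∅)},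
      {X // Linked (Fin.tail s) (Fin.tail F) (¬ Disjoint S.1 (F 0)) (S.1 = ∅) X}) where
  toFun X := ⟨⟨X.1 0, ((linked_succ_iff s F h e X.1).1 X.2).1⟩,
    ⟨Fin.tail X.1, ((linked_succ_iff s F h e X.1).1 X.2).2⟩⟩
  invFun Y := ⟨Fin.cons Y.1.1 Y.2.1, (linked_succ_iff s F h e _).2 ⟨Y.1.2, Y.2.2⟩⟩
  left_inv X := Subtype.ext (Fin.cons_self_tail X.1)
  right_inv _ := rfl

theorem card_linked_succ {k : ℕ} {Q : Fin (k + 1) → Type*} [∀ i, Fintype (Q i)] (s : ∀ i, Q i)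
    (F : ∀ i, Finset (Q i)) {h e : Prop} {T : Finset (Finset (Q 0))}
    (hT : ∀ S, S ∈ T ↔ (h → s 0 ∈ S) ∧ (e → S = ∅)) :
    Nat.card {X // Linked s F h e X} =
      ∑ S ∈ T,
        Nat.card {X // Linked (Fin.tail s) (Fin.tail F) (¬ Disjoint S (F 0)) (S = ∅) X} := by
  classical
  rw [Nat.card_congr (linkedEquiv s F h e), Nat.card_sigma]
  exact (Finset.sum_subtype T hT
    (fun S => Nat.card {X // Linked (Fin.tail s) (Fin.tail F) (¬ Disjoint S (F 0)) (S = ∅) X})).symm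

theorem card_linked_empty {k : ℕ} : ∀ {Q : Fin k → Type*} [∀ i, Fintype (Q i)] (s : ∀ i, Q i)
    (F : ∀ i, Finset (Q i)), Nat.card {X // Linked s F False True X} = 1 := by
  classical
  induction k with
  | zero => intros; simp [Linked]
  | succ k ih =>
    intro Q _ s F
    rw [card_linked_succ (T := {∅}) s F (by simp), Finset.sum_singleton]
    simpa using ih (Fin.tail s) (Fin.tail F)

open Classical in
theorem card_filter_mem {β : Type*} [Fintype β] (s : β) :
    (Finset.univ.filter fun S : Finset β => s ∈ S).card = 2 ^ (Fintype.card β - 1) := by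
  have e : (Finset.univ.filter fun S : Finset β => s ∈ S) = Finset.Icc {s} Finset.univ := by
    ext; simp
  rw [e, Finset.card_Icc_finset (Finset.subset_univ _)]
  simp

open Classical in
theorem card_filter_mem_disjoint {β : Type*} [Fintype β] (s : β) (F : Finset β) :
    (Finset.univ.filter fun S : Finset β => s ∈ S ∧ Disjoint S F).card =
      if s ∈ F then 0 else 2 ^ (Fintype.card β - F.card - 1) := by
  have e : (Finset.univ.filter fun S : Finset β => s ∈ S ∧ Disjoint S F) = Finset.Icc {s} Fᶜ := by
    ext; simp [Finset.subset_compl_iff_disjoint_right]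
  split_ifs with h
  · rw [Finset.card_eq_zero, Finset.filter_eq_empty_iff]
    rintro S - ⟨h1, h2⟩
    exact Finset.disjoint_left.1 h2 h1 h
  · rw [e, Finset.card_Icc_finset (by simpa using h), Finset.card_compl]
    simp

open Classical in
theorem card_filter_disjoint {β : Type*} [Fintype β] (F : Finset β) :
    (Finset.univ.filter fun S : Finset β => Disjoint S F).card =
      2 ^ (Fintype.card β - F.card) := by
  have e : (Finset.univ.filter fun S : Finset β => Disjoint S F) = Fᶜ.powerset := by
    ext; simp [Finset.subset_compl_iff_disjoint_right]
  rw [e, Finset.card_powerset, Finset.card_compl]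

open Classical in
theorem card_linked_hit_succ {k : ℕ} {Q : Fin (k + 1) → Type*} [∀ i, Fintype (Q i)]
    (s : ∀ i, Q i) (F : ∀ i, Finset (Q i)) :
    (Nat.card {X // Linked s F True False X} : ℤ) =
      (2 ^ (Fintype.card (Q 0) - 1) -
        if s 0 ∈ F 0 then 0 else 2 ^ (Fintype.card (Q 0) - (F 0).card - 1)) *
          Nat.card {X // Linked (Fin.tail s) (Fin.tail F) True False X} +
        (if s 0 ∈ F 0 then 0 else 2 ^ (Fintype.card (Q 0) - (F 0).card - 1)) *
          Nat.card {X // Linked (Fin.tail s) (Fin.tail F) False False X} := by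
  have e : ∑ S ∈ Finset.univ.filter (fun S : Finset (Q 0) => s 0 ∈ S),
        Nat.card {X // Linked (Fin.tail s) (Fin.tail F) (¬ Disjoint S (F 0)) (S = ∅) X} =
      ∑ S ∈ Finset.univ.filter (fun S : Finset (Q 0) => s 0 ∈ S), if Disjoint S (F 0) then
        Nat.card {X // Linked (Fin.tail s) (Fin.tail F) False False X} else
        Nat.card {X // Linked (Fin.tail s) (Fin.tail F) True False X} := by
    refine Finset.sum_congr rfl fun S hS => ?_
    have h1 : (S = ∅) = False := by
      rw [eq_iff_iff, iff_false]; rintro rfl; simp at hS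
    split_ifs with h <;> simp [h1, h]
  rw [card_linked_succ (T := Finset.univ.filter (s 0 ∈ ·)) s F (by simp), e, Finset.sum_ite,
    Finset.sum_const, Finset.sum_const]
  have h1 := Finset.card_filter_add_card_filter_not
    (s := Finset.univ.filter (fun S : Finset (Q 0) => s 0 ∈ S)) (fun S => Disjoint S (F 0))
  rw [card_filter_mem] at h1
  have h2 := card_filter_mem_disjoint (s 0) (F 0)
  rw [← Finset.filter_filter] at h2
  rw [h2] at h1 ⊢
  have h3 := congrArg (Nat.cast : ℕ → ℤ) h1
  push_cast at h3
  push_cast [smul_eq_mul]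
  rw [← h3]
  ring

open Classical in
theorem card_linked_miss_succ {k : ℕ} {Q : Fin (k + 1) → Type*} [∀ i, Fintype (Q i)]
    (s : ∀ i, Q i) (F : ∀ i, Finset (Q i)) :
    (Nat.card {X // Linked s F False False X} : ℤ) =
      1 + (2 ^ Fintype.card (Q 0) - 2 ^ (Fintype.card (Q 0) - (F 0).card)) *
          Nat.card {X // Linked (Fin.tail s) (Fin.tail F) True False X} +
        (2 ^ (Fintype.card (Q 0) - (F 0).card) - 1) *
          Nat.card {X // Linked (Fin.tail s) (Fin.tail F) False False X} := by
  -- The empty set is disjoint from `F 0` and would be counted as a miss; the last summand corrects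
  -- its contribution to 1, its only continuation being empty throughout.
  have e : ∑ S : Finset (Q 0),
        (Nat.card {X // Linked (Fin.tail s) (Fin.tail F) (¬ Disjoint S (F 0)) (S = ∅) X} : ℤ) =
      ∑ S : Finset (Q 0), ((if Disjoint S (F 0) then
        (Nat.card {X // Linked (Fin.tail s) (Fin.tail F) False False X} : ℤ) else
        Nat.card {X // Linked (Fin.tail s) (Fin.tail F) True False X}) + if S = ∅ then
        1 - (Nat.card {X // Linked (Fin.tail s) (Fin.tail F) False False X} : ℤ) else 0) := by
    refine Finset.sum_congr rfl fun S hS => ?_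
    by_cases h0 : S = ∅
    · subst h0
      simp [-Nat.card_eq_fintype_card, card_linked_empty]
    · split_ifs with h <;> simp [h0, h]
  rw [card_linked_succ (T := Finset.univ) s F (by simp), Nat.cast_sum, e,
    Finset.sum_add_distrib, Finset.sum_ite, Finset.sum_const, Finset.sum_const,
    Finset.sum_ite_eq' Finset.univ ∅, if_pos (Finset.mem_univ _)]
  have h1 := Finset.card_filter_add_card_filter_not
    (s := (Finset.univ : Finset (Finset (Q 0)))) (fun S => Disjoint S (F 0))
  have h2 := card_filter_disjoint (F 0)
  rw [h2, Finset.card_univ, Fintype.card_finset] at h1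
  rw [h2]
  have h3 := congrArg (Nat.cast : ℕ → ℤ) h1
  push_cast at h3
  simp only [nsmul_eq_mul]
  push_cast
  rw [← h3]
  ring

/-- Of `y` sets, `d` are misses with weight `b` and the others hits with weight `a`. Raising the
weights, and then the number of misses from `d` to `x`, cannot decrease the total as long as a miss
weighs at least as much as a hit. -/
theorem mixture_le {d x y a b a' b' : ℤ} (h0 : 0 ≤ d) (hd : d ≤ x) (hx : d ≤ y) (ha : a ≤ a')
    (hb : b ≤ b') (hab : a' ≤ b') : (y - d) * a + d * b ≤ (y - x) * a' + x * b' := by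
  nlinarith [mul_nonneg h0 (sub_nonneg.2 hb), mul_nonneg (sub_nonneg.2 hx) (sub_nonneg.2 ha),
    mul_nonneg (sub_nonneg.2 hd) (sub_nonneg.2 hab)]

/-- `F i` may have more than `f` elements and may contain `s i`. Either change leaves fewer sets
that miss `F i`, which `mixture_le` turns into a smaller count. -/
theorem card_linked_le {k : ℕ} (n f : ℕ → ℕ) : ∀ (c : ℕ) {Q : Fin k → Type*} [∀ i, Fintype (Q i)]
    (s : ∀ i, Q i) (F : ∀ i, Finset (Q i)), (∀ i, Fintype.card (Q i) = n (c + i)) →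
    (∀ i : Fin k, f (c + i) ≤ (F i).card) → (∀ i < k, f (c + i) < n (c + i)) →
    (Nat.card {X // Linked s F True False X} : ℤ) ≤ tailCount n f k c true ∧
    (Nat.card {X // Linked s F False False X} : ℤ) ≤ tailCount n f k c false := by
  classical
  induction k with
  | zero => intros; simp [Linked, tailCount]
  | succ k ih =>
    intro c Q _ s F hQ hF hf
    have hf' : ∀ i < k, f (c + 1 + i) < n (c + 1 + i) := fun i hi => by
      have := hf (i + 1) (by omega)
      rwa [show c + (i + 1) = c + 1 + i by ring] at this
    obtain ⟨i1, i2⟩ := ih (c + 1) (Fin.tail s) (Fin.tail F)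
      (fun i => by rw [hQ, Fin.val_succ]; congr 1; ring)
      (fun i => by
        have := hF i.succ
        rwa [Fin.val_succ, show c + (i + 1 : ℕ) = c + 1 + i by ring] at this) hf'
    obtain ⟨b1, b2⟩ := tailCount_bounds n f k (c + 1) hf'
    have hn := hQ 0
    have h0 := hf 0 (by omega)
    have h1 := hF 0
    simp only [Fin.val_zero, add_zero] at hn h0 h1
    rw [card_linked_hit_succ, card_linked_miss_succ, hn, tailCount, tailCount]
    have p1 : (2 : ℤ) ^ (n c - (F 0).card - 1) ≤ 2 ^ (n c - f c - 1) :=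
      pow_le_pow_right₀ (by norm_num) (by omega)
    have p2 : (2 : ℤ) ^ (n c - f c - 1) ≤ 2 ^ (n c - 1) :=
      pow_le_pow_right₀ (by norm_num) (by omega)
    have p3 : (2 : ℤ) ^ (n c - (F 0).card) ≤ 2 ^ (n c - f c) :=
      pow_le_pow_right₀ (by norm_num) (by omega)
    have p4 : (2 : ℤ) ^ (n c - f c) ≤ 2 ^ n c :=
      pow_le_pow_right₀ (by norm_num) (by omega)
    have p5 : (1 : ℤ) ≤ 2 ^ (n c - (F 0).card) := one_le_pow₀ (by norm_num)
    have p6 : (0 : ℤ) < 2 ^ (n c - (F 0).card - 1) := by positivity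
    constructor
    · refine mixture_le ?_ ?_ ?_ i1 i2 b2 <;> split_ifs <;> linarith
    · have := mixture_le (d := 2 ^ (n c - (F 0).card) - 1) (x := 2 ^ (n c - f c) - 1)
        (y := 2 ^ n c - 1) (by linarith) (by linarith) (by linarith) i1 i2 b2
      linarith

/-- If `s i ∉ F i`, the sets containing `s i` and missing `F i` number exactly `2 ^ (n - f - 1)`, so
the recursion holds with equality. -/
theorem card_linked_eq {k : ℕ} (n f : ℕ → ℕ) : ∀ (c : ℕ) {Q : Fin k → Type*} [∀ i, Fintype (Q i)]
    (s : ∀ i, Q i) (F : ∀ i, Finset (Q i)), (∀ i, Fintype.card (Q i) = n (c + i)) →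
    (∀ i, (F i).card = f (c + i)) → (∀ i, s i ∉ F i) →
    (Nat.card {X // Linked s F True False X} : ℤ) = tailCount n f k c true ∧
    (Nat.card {X // Linked s F False False X} : ℤ) = tailCount n f k c false := by
  classical
  induction k with
  | zero => intros; simp [Linked, tailCount]
  | succ k ih =>
    intro c Q _ s F hQ hF hs
    obtain ⟨i1, i2⟩ := ih (c + 1) (Fin.tail s) (Fin.tail F)
      (fun i => by rw [hQ, Fin.val_succ]; congr 1; ring)
      (fun i => by rw [Fin.tail, hF, Fin.val_succ]; congr 1; ring) (fun i => hs i.succ)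
    have hn := hQ 0
    have h1 := hF 0
    simp only [Fin.val_zero, add_zero] at hn h1
    rw [card_linked_hit_succ, card_linked_miss_succ, hn, h1, i1, i2, tailCount, tailCount,
      if_neg (hs 0)]
    exact ⟨rfl, rfl⟩

/-- The tuples that can occur as states of the subset automaton of a catenation. -/
def Valid {k : ℕ} {Q : Fin k → Type*} (s : ∀ i, Q i) (F X : ∀ i, Finset (Q i)) : Prop :=
  (∀ i : Fin k, (i : ℕ) = 0 → (X i).card = 1) ∧
  ∀ i j : Fin k, (i : ℕ) + 1 = j → (¬ Disjoint (X i) (F i) → s j ∈ X j) ∧ (X i = ∅ → X j = ∅)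

theorem valid_cons_iff {k : ℕ} {Q : Fin (k + 1) → Type*} (s : ∀ i, Q i)
    (F : ∀ i, Finset (Q i)) (q : Q 0) (X : ∀ i : Fin k, Finset (Q i.succ)) :
    Valid s F (Fin.cons {q} X : ∀ i, Finset (Q i)) ↔
      Linked (Fin.tail s) (Fin.tail F) (q ∈ F 0) False X := by
  have h := linked_succ_iff s F False False (Fin.cons {q} X : ∀ i, Finset (Q i))
  simp only [Fin.cons_zero, Fin.tail_cons, Finset.disjoint_singleton_left, not_not,
    Finset.singleton_ne_empty, false_imp_iff, true_and] at h
  rw [← h]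
  constructor
  · exact fun h => ⟨by simp, h.2⟩
  · refine fun h => ⟨fun i hi => ?_, h.2⟩
    obtain rfl : i = 0 := Fin.ext hi
    simp

/-- A valid tuple is a state followed by a linked tuple. -/
noncomputable def validEquiv {k : ℕ} {Q : Fin (k + 1) → Type*} (s : ∀ i, Q i)
    (F : ∀ i, Finset (Q i)) :
    (Σ q : Q 0, {X // Linked (Fin.tail s) (Fin.tail F) (q ∈ F 0) False X}) ≃
      {X // Valid s F X} := by
  refine Equiv.ofBijective
    (fun Y => ⟨Fin.cons {Y.1} Y.2.1, (valid_cons_iff s F Y.1 Y.2.1).2 Y.2.2⟩) ⟨?_, ?_⟩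
  · rintro ⟨q, X, hX⟩ ⟨q', X', hX'⟩ h
    have h := congrArg Subtype.val h
    have h0 := congrFun h 0
    have h1 := congrArg Fin.tail h
    simp only [Fin.cons_zero, Finset.singleton_inj] at h0
    simp only [Fin.tail_cons] at h1
    subst h0 h1
    rfl
  · rintro ⟨X, hX⟩
    obtain ⟨q, hq⟩ := Finset.card_eq_one.1 (hX.1 0 rfl)
    have e : (Fin.cons {q} (Fin.tail X) : ∀ i, Finset (Q i)) = X := by
      rw [← hq, Fin.cons_self_tail]
    exact ⟨⟨q, Fin.tail X, (valid_cons_iff s F q _).1 (e ▸ hX)⟩, Subtype.ext e⟩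

theorem card_valid {k : ℕ} {Q : Fin (k + 1) → Type*} [∀ i, Fintype (Q i)] (s : ∀ i, Q i)
    (F : ∀ i, Finset (Q i)) : (Nat.card {X // Valid s F X} : ℤ) =
      (F 0).card * Nat.card {X // Linked (Fin.tail s) (Fin.tail F) True False X} +
        ((Fintype.card (Q 0) : ℤ) - (F 0).card) *
          Nat.card {X // Linked (Fin.tail s) (Fin.tail F) False False X} := by
  classical
  have e : ∀ q, Nat.card {X // Linked (Fin.tail s) (Fin.tail F) (q ∈ F 0) False X} =
      if q ∈ F 0 then Nat.card {X // Linked (Fin.tail s) (Fin.tail F) True False X} else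
        Nat.card {X // Linked (Fin.tail s) (Fin.tail F) False False X} := by
    intro q; split_ifs with h <;> simp [h]
  rw [← Nat.card_congr (validEquiv s F), Nat.card_sigma]
  simp only [e]
  rw [Finset.sum_ite, Finset.sum_const, Finset.sum_const]
  have h2 := Finset.card_filter_add_card_filter_not (s := (Finset.univ : Finset (Q 0))) (· ∈ F 0)
  rw [Finset.card_univ] at h2
  have h1 : (Finset.univ.filter (· ∈ F 0)).card = (F 0).card := by congr 1; ext; simp
  rw [h1] at h2 ⊢
  have h3 := congrArg (Nat.cast : ℕ → ℤ) h2
  push_cast at h3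
  push_cast [smul_eq_mul]
  rw [← h3]
  ring

theorem card_valid_le {k : ℕ} (n f : ℕ → ℕ) {Q : Fin (k + 1) → Type*} [∀ i, Fintype (Q i)]
    (s : ∀ i, Q i) (F : ∀ i, Finset (Q i)) (hQ : ∀ i, Fintype.card (Q i) = n (i + 1))
    (hF : ∀ i : Fin (k + 1), f (i + 1) ≤ (F i).card)
    (hf : ∀ i : Fin (k + 1), f (i + 1) < n (i + 1)) :
    (Nat.card {X // Valid s F X} : ℤ) ≤ catBound (k + 1) n f := by
  have hf' : ∀ j, 2 ≤ j → j ≤ k + 1 → f j < n j := fun j h1 h2 => by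
    have := hf ⟨j - 1, by omega⟩
    rwa [Nat.sub_add_cancel (by omega)] at this
  have h2 : ∀ i < k, f (2 + i) < n (2 + i) := fun i hi => hf' _ (by omega) (by omega)
  obtain ⟨i1, i2⟩ := card_linked_le n f 2 (Fin.tail s) (Fin.tail F)
    (fun i => by rw [hQ, Fin.val_succ]; congr 1; ring)
    (fun i => by
      have := hF i.succ
      rwa [Fin.val_succ, show (i + 1 + 1 : ℕ) = 2 + i by ring] at this) h2
  have b := (tailCount_bounds n f k 2 h2).2
  have hn := hQ 0
  have h0 := hF 0
  have hc := Finset.card_le_univ (F 0)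
  simp only [Fin.val_zero, zero_add] at hn h0
  rw [hn] at hc
  rw [catBound_eq k n f hf', card_valid, hn]
  have := mixture_le (d := (n 1 : ℤ) - (F 0).card) (x := n 1 - f 1) (y := n 1)
    (by linarith [(Nat.cast_le (α := ℤ)).2 hc]) (by linarith [(Nat.cast_le (α := ℤ)).2 h0])
    (by simp) i1 i2 b
  linarith

theorem card_valid_eq {k : ℕ} (n f : ℕ → ℕ) {Q : Fin (k + 1) → Type*} [∀ i, Fintype (Q i)]
    (s : ∀ i, Q i) (F : ∀ i, Finset (Q i)) (hQ : ∀ i, Fintype.card (Q i) = n (i + 1))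
    (hF : ∀ i, (F i).card = f (i + 1)) (hf : ∀ i : Fin (k + 1), f (i + 1) < n (i + 1))
    (hs : ∀ i, s i ∉ F i) : (Nat.card {X // Valid s F X} : ℤ) = catBound (k + 1) n f := by
  obtain ⟨i1, i2⟩ := card_linked_eq n f 2 (Fin.tail s) (Fin.tail F)
    (fun i => by rw [hQ, Fin.val_succ]; congr 1; ring)
    (fun i => by rw [Fin.tail, hF, Fin.val_succ]; congr 1; ring) (fun i => hs i.succ)
  rw [catBound_eq k n f, card_valid, hQ, hF, i1, i2]
  · rfl
  · intro j h1 h2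
    have := hf ⟨j - 1, by omega⟩
    rwa [Nat.sub_add_cancel (by omega)] at this

/-! ### Tracking the automata along a word -/

/-- The catenation of the first `i` languages. -/
def prefixLang {α : Type*} {k : ℕ} (L : Fin k → Language α) (i : ℕ) : Language α :=
  ((List.ofFn L).take i).prod

theorem prefixLang_zero {α : Type*} {k : ℕ} (L : Fin k → Language α) : prefixLang L 0 = 1 := by
  simp [prefixLang]

theorem prefixLang_succ {α : Type*} {k : ℕ} (L : Fin k → Language α) (i : Fin k) :
    prefixLang L (i + 1) = prefixLang L i * L i := by
  rw [prefixLang, List.prod_take_succ _ _ (by simp), prefixLang]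
  simp

theorem prefixLang_self {α : Type*} {k : ℕ} (L : Fin k → Language α) :
    prefixLang L k = catenation L := by
  rw [prefixLang, catenation, List.take_of_length_le (by simp)]

/-- The catenation of the languages of the first `i` automata. -/
def acceptedPrefix {α : Type*} {k : ℕ} {Q : Fin k → Type*} (A : ∀ i, DFA α (Q i)) (i : ℕ) :
    Language α := prefixLang (fun i => (A i).accepts) i

theorem mem_acceptedPrefix_zero {α : Type*} {k : ℕ} {Q : Fin k → Type*} (A : ∀ i, DFA α (Q i))
    {w : List α} : w ∈ acceptedPrefix A 0 ↔ w = [] := by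
  rw [acceptedPrefix, prefixLang_zero, Language.mem_one]

section Track

variable {α : Type*} {k : ℕ} {Q : Fin k → Type*} [∀ i, Fintype (Q i)] (A : ∀ i, DFA α (Q i))

open Classical in
/-- The final states of the `i`-th automaton. -/
noncomputable def finals (i : Fin k) : Finset (Q i) := Finset.univ.filter (· ∈ (A i).accept)

theorem mem_finals {i : Fin k} {q : Q i} : q ∈ finals A i ↔ q ∈ (A i).accept := by
  simp [finals]

theorem card_finals (i : Fin k) : (finals A i).card = (A i).accept.ncard := by
  rw [← Set.ncard_coe_finset]
  congr 1
  ext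
  simp [mem_finals]

open Classical in
/-- The states of the `i`-th automaton in which one can be after the word `w`, if one enters this
automaton after a prefix of `w` accepted by the preceding ones. -/
noncomputable def track (w : List α) (i : Fin k) : Finset (Q i) :=
  Finset.univ.filter fun q => ∃ u ∈ acceptedPrefix A i, ∃ v, u ++ v = w ∧ (A i).eval v = q

theorem mem_track {w : List α} {i : Fin k} {q : Q i} :
    q ∈ track A w i ↔ ∃ u ∈ acceptedPrefix A i, ∃ v, u ++ v = w ∧ (A i).eval v = q := by
  simp [track]

theorem mem_acceptedPrefix_succ {w : List α} (i : Fin k) :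
    w ∈ acceptedPrefix A (i + 1) ↔ ¬ Disjoint (track A w i) (finals A i) := by
  rw [acceptedPrefix, prefixLang_succ, Language.mem_mul, Finset.not_disjoint_iff]
  constructor
  · rintro ⟨u, hu, v, hv, rfl⟩
    exact ⟨(A i).eval v, (mem_track A).2 ⟨u, hu, v, rfl, rfl⟩, (mem_finals A).2 hv⟩
  · rintro ⟨q, h1, h2⟩
    obtain ⟨u, hu, v, hv, rfl⟩ := (mem_track A).1 h1
    exact ⟨u, hu, v, (mem_finals A).1 h2, hv⟩

theorem start_mem_track {w : List α} {i : Fin k} (h : w ∈ acceptedPrefix A i) :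
    (A i).start ∈ track A w i :=
  (mem_track A).2 ⟨w, h, [], by simp, rfl⟩

theorem mem_track_nil {i : Fin k} {q : Q i} :
    q ∈ track A [] i ↔ [] ∈ acceptedPrefix A i ∧ q = (A i).start := by
  rw [mem_track]
  constructor
  · rintro ⟨u, hu, v, huv, rfl⟩
    obtain ⟨rfl, rfl⟩ := List.append_eq_nil_iff.1 huv
    exact ⟨hu, rfl⟩
  · rintro ⟨h, rfl⟩
    exact ⟨[], h, [], rfl, rfl⟩

theorem mem_track_append_singleton {w : List α} {a : α} {i : Fin k} {q : Q i} :
    q ∈ track A (w ++ [a]) i ↔ (∃ p ∈ track A w i, (A i).step p a = q) ∨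
      (w ++ [a] ∈ acceptedPrefix A i ∧ q = (A i).start) := by
  constructor
  · intro h
    obtain ⟨u, hu, v, huv, rfl⟩ := (mem_track A).1 h
    rcases List.eq_nil_or_concat v with rfl | ⟨v, b, rfl⟩
    · rw [List.append_nil] at huv
      exact Or.inr ⟨huv ▸ hu, rfl⟩
    · rw [List.concat_eq_append, ← List.append_assoc] at huv
      obtain ⟨rfl, hb⟩ := List.append_inj' huv rfl
      obtain rfl : b = a := by simpa using hb
      exact Or.inl ⟨(A i).eval v, (mem_track A).2 ⟨u, hu, v, rfl, rfl⟩, by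
        simp [DFA.eval_append_singleton]⟩
  · rintro (⟨p, hp, rfl⟩ | ⟨h, rfl⟩)
    · obtain ⟨u, hu, v, rfl, rfl⟩ := (mem_track A).1 hp
      exact (mem_track A).2 ⟨u, hu, v ++ [a], by simp, by simp [DFA.eval_append_singleton]⟩
    · exact start_mem_track A h

theorem track_valid (w : List α) : Valid (fun i => (A i).start) (finals A) (track A w) := by
  refine ⟨fun i hi => Finset.card_eq_one.2 ⟨(A i).eval w, ?_⟩, fun i j hij => ⟨fun h => ?_, ?_⟩⟩
  · ext q
    rw [mem_track, hi, Finset.mem_singleton]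
    constructor
    · rintro ⟨u, hu, v, rfl, rfl⟩
      rw [mem_acceptedPrefix_zero] at hu
      simp [hu]
    · rintro rfl
      exact ⟨[], (mem_acceptedPrefix_zero A).2 rfl, w, rfl, rfl⟩
  · rw [← mem_acceptedPrefix_succ, hij] at h
    exact start_mem_track A h
  -- A run of the later automaton starts after a prefix that already factors through the earlier
  -- language, so the earlier automaton has a run as well.
  · contrapose!
    rintro ⟨q, hq⟩
    obtain ⟨u, hu, v, rfl, -⟩ := (mem_track A).1 hq
    rw [← hij, acceptedPrefix, prefixLang_succ, Language.mem_mul] at hu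
    obtain ⟨u, hu, u', -, rfl⟩ := hu
    exact ⟨_, (mem_track A).2 ⟨u, hu, u' ++ v, by simp, rfl⟩⟩

/-- Whether the initial state enters the `i`-th set depends on the new set at `i - 1`, not on the
old one; hence the induction along the indices. -/
theorem track_append_singleton_congr {w w' : List α} (h : track A w = track A w') (a : α) :
    track A (w ++ [a]) = track A (w' ++ [a]) := by
  have key : ∀ m, ∀ i : Fin k, (i : ℕ) = m →
      track A (w ++ [a]) i = track A (w' ++ [a]) i := by
    intro m
    induction m with
    | zero =>
      intro i hi
      ext q
      simp only [mem_track_append_singleton, hi, mem_acceptedPrefix_zero, h]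
      simp
    | succ m ih =>
      intro i hi
      ext q
      have := mem_acceptedPrefix_succ A (w := w ++ [a]) ⟨m, by omega⟩
      rw [ih ⟨m, by omega⟩ rfl, ← mem_acceptedPrefix_succ] at this
      simp only [mem_track_append_singleton, hi, h, this]
  exact funext fun i => key _ i rfl

theorem mem_catenation_congr (hk : 0 < k) {w w' : List α} (h : track A w = track A w') :
    w ∈ catenation (fun i => (A i).accepts) ↔ w' ∈ catenation fun i => (A i).accepts := by
  obtain ⟨k, rfl⟩ := Nat.exists_eq_succ_of_ne_zero hk.ne'
  have := fun w => mem_acceptedPrefix_succ A (w := w) (Fin.last k)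
  rw [← prefixLang_self]
  exact (this w).trans ((h ▸ this w').symm)

end Track

/-! ### Numbers of states -/

/-- A right-congruent map to a finite type that recognizes `L` yields automata of every size that is
large enough. -/
theorem hasDFA_of_invariant {α σ : Type*} [Finite σ] (L : Language α) (φ : List α → σ)
    (h1 : ∀ w w', φ w = φ w' → ∀ a, φ (w ++ [a]) = φ (w' ++ [a]))
    (h2 : ∀ w w', φ w = φ w' → (w ∈ L ↔ w' ∈ L)) {N : ℕ} (hN : Nat.card σ ≤ N) : HasDFA L N := by
  classical
  have := Fintype.ofFinite σ
  obtain ⟨e⟩ : Nonempty (σ ↪ Fin N) := Function.Embedding.nonempty_of_card_le (by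
    simpa [Nat.card_eq_fintype_card] using hN)
  let M : DFA α (Fin N) :=
    -- Only values at words need transitions: a representative word is chosen, and `h1` makes the
    -- choice irrelevant. The other states, including the padding up to `N`, are unreachable loops.
    { step := fun x a => if h : ∃ w, e (φ w) = x then e (φ (h.choose ++ [a])) else x
      start := e (φ [])
      accept := {x | ∃ w ∈ L, e (φ w) = x} }
  have key : ∀ w, M.eval w = e (φ w) := by
    intro w
    induction w using List.reverseRecOn with
    | nil => rfl
    | append_singleton w a ih =>
      have hw : ∃ w', e (φ w') = e (φ w) := ⟨w, rfl⟩
      rw [DFA.eval_append_singleton, ih]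
      change (if h : ∃ w', e (φ w') = e (φ w) then _ else _) = _
      rw [dif_pos hw, h1 _ _ (e.injective hw.choose_spec)]
  refine ⟨Fin N, inferInstance, M, Fintype.card_fin N, ?_⟩
  ext w
  rw [DFA.mem_accepts, key]
  exact ⟨fun ⟨w', hw', h⟩ => (h2 _ _ (e.injective h)).1 hw', fun h => ⟨w, h, rfl⟩⟩

/-- If all elements of `σ` are values of `φ`, and words with different values are distinguished by
`L`, then every automaton for `L` has at least as many states as `σ` has elements. -/
theorem card_le_of_hasDFA {α σ : Type*} (L : Language α) (φ : List α → σ)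
    (h1 : Function.Surjective φ)
    (h2 : ∀ w w', φ w ≠ φ w' → ∃ u, ¬ (w ++ u ∈ L ↔ w' ++ u ∈ L)) {m : ℕ} (hm : HasDFA L m) :
    Nat.card σ ≤ m := by
  obtain ⟨τ, _, M, rfl, rfl⟩ := hm
  rw [← Nat.card_eq_fintype_card]
  refine Nat.card_le_card_of_injective (fun x => M.eval (h1 x).choose) fun x y hxy => ?_
  by_contra hne
  obtain ⟨u, hu⟩ := h2 (h1 x).choose (h1 y).choose (by
    rwa [(h1 x).choose_spec, (h1 y).choose_spec])
  refine hu ?_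
  simp only [DFA.mem_accepts, DFA.eval, DFA.evalFrom_of_append] at hxy ⊢
  rw [hxy]

theorem stateComplexity_eq {α : Type*} {L : Language α} {N : ℕ} (h1 : HasDFA L N)
    (h2 : ∀ m, HasDFA L m → N ≤ m) : stateComplexity L = N :=
  le_antisymm (Nat.sInf_le h1) (h2 _ (Nat.sInf_mem (s := {m | HasDFA L m}) ⟨N, h1⟩))

theorem stateComplexity_le {α : Type*} {L : Language α} {N : ℕ} (h : HasDFA L N) :
    stateComplexity L ≤ N := Nat.sInf_le h

theorem hasDFA_of_stateComplexity {α : Type*} {L : Language α} {N : ℕ}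
    (h : stateComplexity L = N) (hN : 0 < N) : HasDFA L N := by
  -- The infimum of the empty set is 0, so a positive value entails regularity.
  have : {m | HasDFA L m}.Nonempty := 
    Nat.nonempty_of_pos_sInf (lt_of_lt_of_eq hN h.symm)
  exact h ▸ Nat.sInf_mem this

theorem one_le_catBound {k : ℕ} (n f : ℕ → ℕ) (hf : ∀ i : Fin (k + 1), f (i + 1) < n (i + 1)) :
    1 ≤ catBound (k + 1) n f := by
  have hf' : ∀ j, 2 ≤ j → j ≤ k + 1 → f j < n j := fun j h1 h2 => by
    have := hf ⟨j - 1, by omega⟩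
    rwa [Nat.sub_add_cancel (by omega)] at this
  obtain ⟨b1, b2⟩ := tailCount_bounds n f k 2 fun i hi => hf' _ (by omega) (by omega)
  have h0 := hf 0
  simp only [Fin.val_zero, zero_add] at h0
  rw [catBound_eq k n f hf']
  have h0' : (f 1 : ℤ) + 1 ≤ n 1 := by exact_mod_cast h0
  have h1 : (0 : ℤ) ≤ f 1 := by positivity
  nlinarith

/-- The upper bound, in terms of lower bounds for the numbers of final states. -/
theorem hasDFA_catenation {α : Type*} {k : ℕ} (n f : ℕ → ℕ) {Q : Fin (k + 1) → Type*}
    [∀ i, Fintype (Q i)] (A : ∀ i, DFA α (Q i)) (hQ : ∀ i, Fintype.card (Q i) = n (i + 1))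
    (hF : ∀ i : Fin (k + 1), f (i + 1) ≤ (finals A i).card)
    (hf : ∀ i : Fin (k + 1), f (i + 1) < n (i + 1)) :
    HasDFA (catenation fun i => (A i).accepts) (catBound (k + 1) n f).toNat := by
  refine hasDFA_of_invariant (σ := {X // Valid (fun i => (A i).start) (finals A) X}) _
    (fun w => ⟨track A w, track_valid A w⟩) (fun w w' h a => ?_) (fun w w' h => ?_) ?_
  · exact Subtype.ext (track_append_singleton_congr A (congrArg Subtype.val h) a)
  · exact mem_catenation_congr A k.succ_pos (congrArg Subtype.val h)
  · exact Int.le_toNat (by linarith [one_le_catBound n f hf]) |>.2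
      (card_valid_le n f _ (finals A) hQ hF hf)

theorem catenation_eq_zero {α : Type*} {k : ℕ} (L : Fin k → Language α) {i : Fin k}
    (h : L i = 0) : catenation L = 0 :=
  List.prod_eq_zero (by rw [List.mem_ofFn]; exact ⟨i, h⟩)

theorem stateComplexity_zero_le {α : Type*} : stateComplexity (0 : Language α) ≤ 1 :=
  stateComplexity_le ⟨Unit, inferInstance, ⟨fun _ _ => (), (), ∅⟩, rfl, by
    ext w; simp [DFA.mem_accepts, Language.notMem_zero]⟩

/-- One final state is the worst case: `hasDFA_catenation` needs only a lower bound on the numbers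
of final states, so it also covers automata in which all states are final. An automaton without
final states makes the catenation empty, and then one state suffices. -/
theorem stateComplexity_catenation_le {α : Type*} {k : ℕ} (n : ℕ → ℕ)
    (hn : ∀ i : Fin (k + 1), 2 ≤ n (i + 1)) (L : Fin (k + 1) → Language α)
    (hL : ∀ i, HasDFA (L i) (n (i + 1))) :
    (stateComplexity (catenation L) : ℤ) ≤ catBound (k + 1) n fun _ => 1 := by
  have h1 := one_le_catBound (k := k) n (fun _ => 1) fun i => hn i
  choose Q hQ A hc hA using hL
  obtain rfl : (fun i => (A i).accepts) = L := funext hA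
  by_cases hF : ∀ i, 1 ≤ (finals A i).card
  · have := stateComplexity_le (hasDFA_catenation n (fun _ => 1) A hc hF fun i => hn i)
    omega
  · push Not at hF
    obtain ⟨i, hi⟩ := hF
    have h0 : (A i).accepts = 0 := by
      ext w
      have : (A i).eval w ∉ finals A i := by
        rw [Finset.card_eq_zero.1 (by omega : (finals A i).card = 0)]; simp
      simpa [mem_finals, DFA.mem_accepts, Language.notMem_zero] using this
    rw [catenation_eq_zero (fun i => (A i).accepts) h0]
    have := stateComplexity_zero_le (α := α)
    omega

/-! ### Automata whose letters are all tuples of transformations -/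

section Witness

variable {k : ℕ} {Q : Fin k → Type} (s t : ∀ i, Q i)

/-- The automaton with initial state `s i` and final state `t i` on which each letter, a tuple of
transformations, acts by its component `i`. -/
def transformationDFA (i : Fin k) : DFA (∀ j, Q j → Q j) (Q i) where
  step q g := g i q
  start := s i
  accept := {t i}

variable [∀ i, Fintype (Q i)]

theorem finals_transformationDFA (i : Fin k) : finals (transformationDFA s t) i = {t i} := by
  ext
  rw [mem_finals, Finset.mem_singleton]
  rfl

theorem mem_acceptedPrefix_succ_iff_mem_track {w : List (∀ j, Q j → Q j)} (i : Fin k) :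
    w ∈ acceptedPrefix (transformationDFA s t) (i + 1) ↔
      t i ∈ track (transformationDFA s t) w i := by
  rw [mem_acceptedPrefix_succ, finals_transformationDFA, Finset.disjoint_singleton_right, not_not]

theorem mem_track_transformationDFA {w : List (∀ j, Q j → Q j)} {g : ∀ j, Q j → Q j} {i : Fin k}
    {q : Q i} : q ∈ track (transformationDFA s t) (w ++ [g]) i ↔
      (∃ p ∈ track (transformationDFA s t) w i, g i p = q) ∨
        (w ++ [g] ∈ acceptedPrefix (transformationDFA s t) i ∧ q = s i) :=
  mem_track_append_singleton _

theorem valid_transformationDFA_iff {X : ∀ i, Finset (Q i)} :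
    Valid (fun i => (transformationDFA s t i).start) (finals (transformationDFA s t)) X ↔
      (∀ i : Fin k, (i : ℕ) = 0 → (X i).card = 1) ∧ ∀ i j : Fin k, (i : ℕ) + 1 = j →
        (t i ∈ X i → s j ∈ X j) ∧ (X i = ∅ → X j = ∅) := by
  simp only [Valid, finals_transformationDFA, Finset.disjoint_singleton_right, not_not]
  rfl

variable {s t}

/-- The letter sends `q` to the final state and all other states of the `i`-th automaton to `s i`.
The initial state that may be added afterwards does no harm, since `s i ≠ t i`. The constant maps to
`t j` elsewhere keep `s j` out of the next set unless it enters as an initial state. -/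
theorem exists_letter_separating (hst : ∀ i, s i ≠ t i) (i : Fin k)
    {w w' : List (∀ j, Q j → Q j)} {q : Q i} (hq : q ∈ track (transformationDFA s t) w i)
    (hq' : q ∉ track (transformationDFA s t) w' i) :
    ∃ g : ∀ j, Q j → Q j, (∀ j, j ≠ i → ∀ x, g j x = t j) ∧
      w ++ [g] ∈ acceptedPrefix (transformationDFA s t) (i + 1) ∧
      w' ++ [g] ∉ acceptedPrefix (transformationDFA s t) (i + 1) := by
  classical
  let g : ∀ j, Q j → Q j := Function.update (fun j _ => t j) i fun x => if x = q then t i else s i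
  have hg : ∀ x, g i x = if x = q then t i else s i := fun x => by simp [g]
  refine ⟨g, fun j hj x => by simp [g, hj], ?_, ?_⟩ <;>
    rw [mem_acceptedPrefix_succ_iff_mem_track, mem_track_transformationDFA]
  · exact Or.inl ⟨q, hq, by simp [hg]⟩
  · rintro (⟨p, hp, h⟩ | ⟨-, h⟩)
    · rw [hg, if_neg (by rintro rfl; exact hq' hp)] at h
      exact hst i h
    · exact hst i h.symm

theorem exists_distinguishing_word (hst : ∀ i, s i ≠ t i) (d : ℕ) :
    ∀ (i : Fin k), (i : ℕ) + d + 1 = k →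
    ∀ (w w' : List (∀ j, Q j → Q j)) (q : Q i), q ∈ track (transformationDFA s t) w i →
      q ∉ track (transformationDFA s t) w' i →
      ∃ u, w ++ u ∈ acceptedPrefix (transformationDFA s t) k ∧
        w' ++ u ∉ acceptedPrefix (transformationDFA s t) k := by
  induction d with
  | zero =>
    intro i hi w w' q hq hq'
    obtain ⟨g, -, h1, h2⟩ := exists_letter_separating hst i hq hq'
    rw [show (i : ℕ) + 1 = k by omega] at h1 h2
    exact ⟨[g], h1, h2⟩
  | succ d ih =>
    intro i hi w w' q hq hq'
    obtain ⟨g, hg, h1, h2⟩ := exists_letter_separating hst i hq hq'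
    let j : Fin k := ⟨i + 1, by omega⟩
    obtain ⟨u, h3, h4⟩ := ih j (by simp [j]; omega) (w ++ [g]) (w' ++ [g]) (s j)
      ((mem_track_transformationDFA s t).2 (Or.inr ⟨h1, rfl⟩)) (by
        rw [mem_track_transformationDFA]
        rintro (⟨p, -, h⟩ | ⟨h, -⟩)
        · rw [hg j (fun h => by simp [j, Fin.ext_iff] at h)] at h
          exact hst j h.symm
        · exact h2 h)
    exact ⟨g :: u, by simpa using h3, by simpa using h4⟩

theorem exists_distinguishing (hst : ∀ i, s i ≠ t i) {w w' : List (∀ j, Q j → Q j)}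
    (h : track (transformationDFA s t) w ≠ track (transformationDFA s t) w') :
    ∃ u, ¬ (w ++ u ∈ catenation (fun i => (transformationDFA s t i).accepts) ↔
      w' ++ u ∈ catenation fun i => (transformationDFA s t i).accepts) := by
  obtain ⟨i, hi⟩ := Function.ne_iff.1 h
  rw [← prefixLang_self]
  have hk : (i : ℕ) + (k - 1 - i) + 1 = k := by omega
  rw [Ne, Finset.ext_iff, not_forall] at hi
  obtain ⟨q, hq⟩ := hi
  by_cases h1 : q ∈ track (transformationDFA s t) w i
  · obtain ⟨u, h2, h3⟩ := exists_distinguishing_word hst _ i hk w w' q h1 (by tauto)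
    exact ⟨u, fun h => h3 (h.1 h2)⟩
  · obtain ⟨u, h2, h3⟩ := exists_distinguishing_word hst _ i hk w' w q (by tauto) h1
    exact ⟨u, fun h => h3 (h.2 h2)⟩

end Witness

/-! ### Reachability of all valid tuples -/

section Reachability

theorem exists_image_eq {β : Type*} [DecidableEq β] {X Z : Finset β} (h : X.card = Z.card) :
    ∃ g : β → β, X.image g = Z := by
  let e := Finset.equivOfCardEq h
  refine ⟨fun x => if hx : x ∈ X then e ⟨x, hx⟩ else x, ?_⟩
  ext z
  rw [Finset.mem_image]
  constructor
  · rintro ⟨x, hx, rfl⟩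
    simp [hx]
  · intro hz
    exact ⟨e.symm ⟨z, hz⟩, (e.symm ⟨z, hz⟩).2, by simp⟩

variable {k : ℕ} {Q : Fin k → Type} [∀ i, Fintype (Q i)] {s t : ∀ i, Q i}

/-- A valid tuple can be reached in one step from a tuple with sets of the same sizes, where a set
may also be smaller by one if the set before it in the target tuple contains the final state. -/
theorem exists_track_append_eq {w : List (∀ j, Q j → Q j)}
    {Y : ∀ i, Finset (Q i)}
    (hY : Valid (fun i => (transformationDFA s t i).start) (finals (transformationDFA s t)) Y)
    (hc : ∀ i, (track (transformationDFA s t) w i).card = (Y i).card ∨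
      ∃ j : Fin k, (j : ℕ) + 1 = i ∧ t j ∈ Y j ∧
        (track (transformationDFA s t) w i).card + 1 = (Y i).card) :
    ∃ g, track (transformationDFA s t) (w ++ [g]) = Y := by
  classical
  rw [valid_transformationDFA_iff] at hY
  -- `Z i` is the part of `Y i` that the letter itself must produce: all of `Y i`, or `Y i` without
  -- `s i`, which is then supplied by the final state in the preceding set.
  have hZ : ∀ i, ∃ Z : Finset (Q i), (track (transformationDFA s t) w i).card = Z.card ∧ Z ⊆ Y i ∧
      (Y i ⊆ Z ∨ ∃ j : Fin k, (j : ℕ) + 1 = i ∧ t j ∈ Y j ∧ ∀ x ∈ Y i, x = s i ∨ x ∈ Z) := by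
    intro i
    rcases hc i with h | ⟨j, hj, htj, h⟩
    · exact ⟨Y i, h, subset_rfl, Or.inl subset_rfl⟩
    · have hs := (hY.2 j i hj).1 htj
      refine ⟨(Y i).erase (s i), ?_, Finset.erase_subset _ _, Or.inr ⟨j, hj, htj, fun x hx => ?_⟩⟩
      · rw [Finset.card_erase_of_mem hs]; omega
      · rw [Finset.mem_erase]; tauto
  choose Z hZc hZY hYZ using hZ
  choose g hg using fun i => exists_image_eq (hZc i)
  have hg' : ∀ i x, (∃ p ∈ track (transformationDFA s t) w i, g i p = x) ↔ x ∈ Z i := by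
    intro i x
    rw [← hg i, Finset.mem_image]
  refine ⟨g, ?_⟩
  have key : ∀ m, ∀ i : Fin k, (i : ℕ) = m → track (transformationDFA s t) (w ++ [g]) i = Y i := by
    intro m
    induction m with
    | zero =>
      intro i hi
      ext x
      rw [mem_track_transformationDFA, hg', hi, mem_acceptedPrefix_zero]
      have : Y i ⊆ Z i := by
        rcases hYZ i with h | ⟨j, hj, -⟩
        · exact h
        · omega
      simpa using ⟨fun h => hZY i h, fun h => this h⟩
    | succ m ih =>
      intro i hi
      let j : Fin k := ⟨m, by omega⟩
      have hji : (j : ℕ) + 1 = i := hi.symm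
      ext x
      rw [mem_track_transformationDFA, hg', ← hji, mem_acceptedPrefix_succ_iff_mem_track, ih j rfl]
      constructor
      · rintro (h | ⟨h, rfl⟩)
        · exact hZY i h
        · exact (hY.2 j i hji).1 h
      · intro hx
        rcases hYZ i with h | ⟨j', hj', htj, h⟩
        · exact Or.inl (h hx)
        · obtain rfl : j' = j := Fin.ext (by omega)
          rcases h x hx with h | h
          · exact Or.inr ⟨htj, h⟩
          · exact Or.inl h
  exact funext fun i => key _ i rfl

theorem track_nil_eq_empty (hst : ∀ i, s i ≠ t i) {i : Fin k} (hi : (i : ℕ) ≠ 0) :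
    track (transformationDFA s t) [] i = ∅ := by
  rw [Finset.eq_empty_iff_forall_notMem]
  intro q hq
  have h := ((mem_track_nil _).1 hq).1
  let j : Fin k := ⟨i - 1, by omega⟩
  have hji : (i : ℕ) = j + 1 := by simp [j]; omega
  rw [hji, mem_acceptedPrefix_succ_iff_mem_track, mem_track_nil] at h
  exact hst j h.2.symm

/-- These canonical sets satisfy the validity conditions as easily as possible: the initial state is
present whenever there is room, and the final state is avoided unless the set is everything.
Validity of a tuple of such sets thus depends on the sizes only. -/
theorem exists_sized_sets {β : Type*} [Fintype β] {s t : β} (hst : s ≠ t) :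
    ∃ C : ℕ → Finset β, ∀ m ≤ Fintype.card β, (C m).card = m ∧ (m ≠ 0 → s ∈ C m) ∧
      (t ∈ C m → m = Fintype.card β) := by
  classical
  have : ∀ m, ∃ C : Finset β, m ≤ Fintype.card β → C.card = m ∧ (m ≠ 0 → s ∈ C) ∧
      (t ∈ C → m = Fintype.card β) := by
    intro m
    rcases Nat.eq_zero_or_pos m with rfl | hm
    · exact ⟨∅, by simp⟩
    rcases lt_trichotomy m (Fintype.card β) with h | rfl | h
    · obtain ⟨C, h1, h2, h3⟩ := Finset.exists_subsuperset_card_eq (n := m)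
        (show {s} ⊆ Finset.univ.erase t by simpa using hst) (by rwa [Finset.card_singleton])
        (by rw [Finset.card_erase_of_mem (Finset.mem_univ _), Finset.card_univ]; omega)
      exact ⟨C, fun _ => ⟨h3, fun _ => h1 (by simp), fun ht => by simpa using h2 ht⟩⟩
    · exact ⟨Finset.univ, by simp⟩
    · exact ⟨∅, fun h' => by omega⟩
  choose C hC using this
  exact ⟨C, hC⟩

/-- This finds a set that may shrink by one element: if it becomes empty, all later ones are empty
already, and singletons before it can be steered to put the element back. The largest index with `m
i ≠ 0` has the last property; for the least such index, minimality forces every earlier size to be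
1. -/
theorem exists_critical_index {m : Fin k → ℕ}
    (hm : ∀ i j : Fin k, (i : ℕ) + 1 = j → m i = 0 → m j = 0)
    (h0 : ∀ i : Fin k, (i : ℕ) = 0 → m i = 1) (h : ∃ i : Fin k, (i : ℕ) ≠ 0 ∧ m i ≠ 0) :
    ∃ i : Fin k, (i : ℕ) ≠ 0 ∧ m i ≠ 0 ∧ (∀ j < i, m j = 1) ∧ (m i = 1 → ∀ j > i, m j = 0) := by
  classical
  have anti : ∀ d, ∀ i j : Fin k, (i : ℕ) + d = j → m i = 0 → m j = 0 := by
    intro d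
    induction d with
    | zero => intro i j hij hi; rwa [← show i = j from Fin.ext (by simpa using hij)]
    | succ d ih =>
      intro i j hij hi
      exact hm ⟨i + d, by omega⟩ j (by simp; omega) (ih i _ rfl hi)
  obtain ⟨a, ha, hmax⟩ := Finset.exists_max_image
    (Finset.univ.filter fun i : Fin k => (i : ℕ) ≠ 0 ∧ m i ≠ 0) id
    (by obtain ⟨i, hi⟩ := h; exact ⟨i, by simpa using hi⟩)
  obtain ⟨i, hi, hmin⟩ := Finset.exists_min_image
    (Finset.univ.filter fun i : Fin k => (i : ℕ) ≠ 0 ∧ m i ≠ 0 ∧ (m i = 1 → ∀ j > i, m j = 0)) id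
    (by
      refine ⟨a, ?_⟩
      simp only [Finset.mem_filter, Finset.mem_univ, true_and, id] at ha hmax ⊢
      refine ⟨ha.1, ha.2, fun _ j hj => ?_⟩
      by_contra hne
      exact absurd (hmax j ⟨by have : (a : ℕ) < j := hj; omega, hne⟩) (not_le.2 hj))
  simp only [Finset.mem_filter, Finset.mem_univ, true_and, id] at hi hmin
  refine ⟨i, hi.1, hi.2.1, fun j hj => ?_, hi.2.2⟩
  by_cases hj0 : (j : ℕ) = 0
  · exact h0 j hj0
  by_contra hne
  have hj' : (j : ℕ) < i := hj
  exact absurd (hmin j ⟨hj0, fun h => hi.2.1 (anti (i - j) j i (by omega) h),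
    fun h => absurd h hne⟩) (not_le.2 hj)

/-- Since a letter can rearrange a tuple into any valid one of the same sizes, only sizes have to be
built up. Shrink `Y i` at a critical index `i` and reach canonical sets of these sizes by induction.
Then one letter moves automaton `p = i - 1` to its final state, which adds `s i` to the `i`-th set,
and a second letter rearranges the result into `Y`. -/
theorem exists_track_eq (hst : ∀ i, s i ≠ t i) (N : ℕ) : ∀ Y : ∀ i, Finset (Q i),
    Valid (fun i => (transformationDFA s t i).start) (finals (transformationDFA s t)) Y →
    ∑ i, (Y i).card = N → ∃ w, track (transformationDFA s t) w = Y := by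
  classical
  induction N using Nat.strong_induction_on with
  | _ N ih =>
  intro Y hY hN
  have hY' := (valid_transformationDFA_iff s t).1 hY
  by_cases hne : ∃ i : Fin k, (i : ℕ) ≠ 0 ∧ (Y i).card ≠ 0
  swap
  · push Not at hne
    obtain ⟨g, hg⟩ := exists_track_append_eq (w := []) hY fun i => Or.inl (by
      by_cases hi : (i : ℕ) = 0
      · rw [hY.1 i hi, (track_valid _ _).1 i hi]
      · rw [hne i hi, track_nil_eq_empty hst hi, Finset.card_empty])
    exact ⟨_, hg⟩
  obtain ⟨i, hi0, hi, hlt, hgt⟩ := exists_critical_index (m := fun i => (Y i).card)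
    (fun i j hij => by simpa only [Finset.card_eq_zero] using (hY.2 i j hij).2) hY.1 hne
  choose C hC using fun i => exists_sized_sets (hst i)
  let p : Fin k := ⟨i - 1, by omega⟩
  have hpi : (p : ℕ) + 1 = i := by simp [p]; omega
  have hp_ne : i ≠ p := by rintro h; rw [← h] at hpi; omega
  have hp : (Y p).card = 1 := hlt p (Fin.lt_def.2 (by omega))
  have hle : ∀ j, (Y j).card ≤ Fintype.card (Q j) := fun j => Finset.card_le_univ _
  -- Two distinct states exist, so a singleton is never full and a canonical singleton does not
  -- contain the final state.
  have hcard : ∀ j, 1 < Fintype.card (Q j) := fun j =>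
    Fintype.one_lt_card_iff.2 ⟨s j, t j, hst j⟩
  have hfull : ∀ j j' : Fin k, (j : ℕ) + 1 = j' → (Y j).card = Fintype.card (Q j) →
      (Y j').card ≠ 0 := by
    intro j j' hj h h'
    have := (hY'.2 j j' hj).1 (by rw [(Finset.card_eq_iff_eq_univ _).1 h]; exact Finset.mem_univ _)
    rw [Finset.card_eq_zero.1 h'] at this
    simp at this
  have hzero : ∀ j j' : Fin k, (j : ℕ) + 1 = j' → (Y j).card = 0 → (Y j').card = 0 := by
    intro j j' hj
    simpa only [Finset.card_eq_zero] using (hY.2 j j' hj).2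
  -- the sizes in the smaller tuple
  let m : Fin k → ℕ := fun j => if j = i then (Y j).card - 1 else (Y j).card
  have hm : ∀ j, j ≠ i → m j = (Y j).card := fun j hj => if_neg hj
  have hmi : m i = (Y i).card - 1 := if_pos rfl
  have hmle : ∀ j, m j ≤ (Y j).card := fun j => by
    by_cases h : j = i
    · subst h; omega
    · rw [hm j h]
  have hC' := fun j => hC j (m j) ((hmle j).trans (hle j))
  have hCY := fun j => hC j _ (hle j)
  have hX : Valid (fun i => (transformationDFA s t i).start) (finals (transformationDFA s t))
      fun j => C j (m j) := by
    rw [valid_transformationDFA_iff]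
    refine ⟨fun j hj => ?_, fun j j' hj => ⟨fun h => (hC' j').2.1 ?_, fun h => ?_⟩⟩
    · rw [(hC' j).1, hm j (by rintro rfl; exact hi0 hj), hY.1 j hj]
    · have h1 := (hC' j).2.2 h
      have h2 := hmle j
      have h3 := hle j
      have h4 := hfull j j' hj (by omega)
      by_cases hji : j' = i
      · subst hji
        obtain rfl : j = p := Fin.ext (by omega)
        have := hcard p
        omega
      · rwa [hm j' hji]
    · have h1 := (hC' j).1
      rw [h, Finset.card_empty] at h1
      rw [← Finset.card_eq_zero, (hC' j').1, ← Nat.le_zero]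
      refine (hmle j').trans (Nat.le_zero.2 ?_)
      by_cases hji : j = i
      · subst hji
        exact hgt (by omega) j' (Fin.lt_def.2 (by omega))
      · exact hzero j j' hj (by rw [← hm j hji, ← h1])
  obtain ⟨w, hw⟩ := ih (∑ j, (C j (m j)).card) (by
    rw [← hN]
    refine Finset.sum_lt_sum (fun j _ => (hC' j).1.trans_le (hmle j)) ⟨i, Finset.mem_univ _, ?_⟩
    rw [(hC' i).1]; omega) _ hX rfl
  -- the tuple in which the automaton `p` is in its final state
  let X : ∀ j, Finset (Q j) := Function.update (fun j => C j (Y j).card) p {t p}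
  have hXp : X p = {t p} := by simp [X]
  have hXj : ∀ j, j ≠ p → X j = C j (Y j).card := fun j hj => by simp [X, hj]
  have hXc : ∀ j, (X j).card = (Y j).card := fun j => by
    by_cases h : j = p
    · subst h; rw [hXp, hp, Finset.card_singleton]
    · rw [hXj j h, (hCY j).1]
  have hXv : Valid (fun i => (transformationDFA s t i).start) (finals (transformationDFA s t))
      X := by
    rw [valid_transformationDFA_iff]
    refine ⟨fun j hj => by rw [hXc, hY.1 j hj], fun j j' hj => ⟨fun h => ?_, ?_⟩⟩
    · by_cases hjp : j = p
      · subst hjp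
        obtain rfl : j' = i := Fin.ext (by omega)
        rw [hXj _ hp_ne]
        exact (hCY _).2.1 hi
      · rw [hXj j hjp] at h
        have h1 := (hCY j).2.2 h
        rw [hXj j' ?_]
        · exact (hCY j').2.1 (hfull j j' hj h1)
        -- A predecessor of `p` is a canonical singleton, hence not full and without its final
        -- state; so it does not demand `s p` in `{t p}`.
        · rintro rfl
          have h2 : (Y j).card = 1 := hlt j (Fin.lt_def.2 (by omega))
          have := hcard j
          omega
    · simpa only [← Finset.card_eq_zero, hXc] using hzero j j' hj
  obtain ⟨g, hg⟩ := exists_track_append_eq (w := w) hXv fun j => by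
    rw [hw, hXc, (hC' j).1]
    by_cases hj : j = i
    · subst hj
      exact Or.inr ⟨p, hpi, by simp [hXp], by omega⟩
    · exact Or.inl (hm j hj)
  obtain ⟨g', hg'⟩ := exists_track_append_eq (w := w ++ [g]) hY fun j => by
    rw [hg]; exact Or.inl (hXc j)
  exact ⟨_, hg'⟩

end Reachability

/-! ### The lower bound and the exact state complexity -/

theorem card_le_of_hasDFA_transformationDFA {k : ℕ} {Q : Fin k → Type} [∀ i, Fintype (Q i)]
    {s t : ∀ i, Q i} (hst : ∀ i, s i ≠ t i) {m : ℕ}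
    (hm : HasDFA (catenation fun i => (transformationDFA s t i).accepts) m) :
    Nat.card {X // Valid s (finals (transformationDFA s t)) X} ≤ m := by
  refine card_le_of_hasDFA _ (fun w => ⟨track (transformationDFA s t) w, track_valid _ w⟩)
    ?_ (fun w w' h => ?_) hm
  · rintro ⟨Y, hY⟩
    obtain ⟨w, hw⟩ := exists_track_eq hst _ Y hY rfl
    exact ⟨w, Subtype.ext hw⟩
  · exact exists_distinguishing hst fun h' => h (Subtype.ext h')

theorem stateComplexity_transformationDFA {k : ℕ} {Q : Fin k → Type} [∀ i, Fintype (Q i)]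
    {s t : ∀ i, Q i} (hst : ∀ i, s i ≠ t i) (i : Fin k) :
    stateComplexity (transformationDFA s t i).accepts = Fintype.card (Q i) := by
  classical
  refine stateComplexity_eq ⟨Q i, inferInstance, _, rfl, rfl⟩ fun m hm => ?_
  rw [← Nat.card_eq_fintype_card]
  refine card_le_of_hasDFA _ (transformationDFA s t i).eval (fun q => ?_) (fun w w' h => ?_) hm
  · refine ⟨[Function.update (fun _ x => x) i fun _ => q], ?_⟩
    simp [DFA.eval, transformationDFA]
  -- This letter sends the state reached by `w` to the final state and all others to the initial
  -- state, so it separates `w` from every word reaching another state.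
  · let g : ∀ j, Q j → Q j := Function.update (fun _ x => x) i fun x =>
      if x = (transformationDFA s t i).eval w then t i else s i
    have hg : ∀ v, v ++ [g] ∈ (transformationDFA s t i).accepts ↔
        (transformationDFA s t i).eval v = (transformationDFA s t i).eval w := by
      intro v
      rw [DFA.mem_accepts, DFA.eval_append_singleton]
      change g i _ ∈ ({t i} : Set (Q i)) ↔ _
      rw [Set.mem_singleton_iff]
      simp only [g, Function.update_self]
      split_ifs with h <;> simp [h, hst i]
    exact ⟨[g], fun h' => h ((hg w').1 (h'.1 ((hg w).2 rfl))).symm⟩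

theorem exists_witness {k : ℕ} (n : ℕ → ℕ) (hn : ∀ i : Fin (k + 1), 2 ≤ n (i + 1)) :
    ∃ (α : Type) (_ : Fintype α) (_ : Nonempty α) (Q : Fin (k + 1) → Type) (_ : ∀ i, Fintype (Q i))
      (A : ∀ i, DFA α (Q i)), (∀ i, Fintype.card (Q i) = n (i + 1)) ∧
      (∀ i, (A i).accept.ncard = 1) ∧ (∀ i, stateComplexity (A i).accepts = n (i + 1)) ∧
      ∀ m : ℕ, HasDFA (catenation fun i => (A i).accepts) m →
        catBound (k + 1) n (fun _ => 1) ≤ (m : ℤ) := by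
  classical
  let Q : Fin (k + 1) → Type := fun i => Fin (n (i + 1))
  let s : ∀ i, Q i := fun i => ⟨0, by have := hn i; omega⟩
  let t : ∀ i, Q i := fun i => ⟨1, by have := hn i; omega⟩
  have hst : ∀ i, s i ≠ t i := fun i h => by simpa [s, t] using congrArg Fin.val h
  have : ∀ i, Fintype (Q i) := fun i => inferInstanceAs (Fintype (Fin (n (i + 1))))
  have hQ : ∀ i, Fintype.card (Q i) = n (i + 1) := fun i => by
    rw [← Nat.card_eq_fintype_card, Nat.card_fin]
  refine ⟨∀ j, Q j → Q j, inferInstance, ⟨fun _ x => x⟩, Q, this, transformationDFA s t, hQ,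
    fun i => Set.ncard_singleton _, fun i => ?_, fun m hm => ?_⟩
  · rw [stateComplexity_transformationDFA hst, hQ]
  · have h := card_valid_eq n (fun _ => 1) s (finals (transformationDFA s t)) hQ
      (fun i => by rw [finals_transformationDFA, Finset.card_singleton]) (fun i => hn i)
      (fun i => by rw [finals_transformationDFA, Finset.mem_singleton]; exact hst i)
    rw [← h]
    exact_mod_cast card_le_of_hasDFA_transformationDFA hst hm

theorem mainTheorem6 (k : ℕ) (hk : 2 ≤ k) (n : ℕ → ℕ) :
    -- the upper bound, for all numbers of final states
    (∀ (f : ℕ → ℕ), (∀ i : Fin k, 0 < f (i + 1) ∧ f (i + 1) < n (i + 1)) →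
      ∀ (α : Type*) (Q : Fin k → Type*) [∀ i, Fintype (Q i)] (A : ∀ i, DFA α (Q i)),
        (∀ i, Fintype.card (Q i) = n (i + 1)) →
        (∀ i, (A i).accept.ncard = f (i + 1)) →
        ∃ (τ : Type) (_ : Fintype τ) (M : DFA α τ),
          (Fintype.card τ : ℤ) = catBound k n f ∧
          M.accepts = catenation fun i => (A i).accepts) ∧
    ((∀ i : Fin k, 2 ≤ n (i + 1)) →
      -- with one final state in each automaton the bound cannot be improved
      (∃ (α : Type) (_ : Fintype α) (_ : Nonempty α) (Q : Fin k → Type) (_ : ∀ i, Fintype (Q i))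
        (A : ∀ i, DFA α (Q i)),
        (∀ i, Fintype.card (Q i) = n (i + 1)) ∧
        (∀ i, (A i).accept.ncard = 1) ∧
        ∀ m : ℕ, HasDFA (catenation fun i => (A i).accepts) m →
          catBound k n (fun _ => 1) ≤ (m : ℤ)) ∧
      -- exact state complexity, for languages accepted by DFAs with `n₁, …, n_k` states
      IsGreatest {m : ℤ | ∃ (α : Type) (_ : Fintype α) (_ : Nonempty α) (L : Fin k → Language α),
          (∀ i, HasDFA (L i) (n (i + 1))) ∧ (stateComplexity (catenation L) : ℤ) = m}
        (catBound k n fun _ => 1) ∧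
      -- exact state complexity, for languages of state complexity `n₁, …, n_k`
      IsGreatest {m : ℤ | ∃ (α : Type) (_ : Fintype α) (_ : Nonempty α) (L : Fin k → Language α),
          (∀ i, stateComplexity (L i) = n (i + 1)) ∧ (stateComplexity (catenation L) : ℤ) = m}
        (catBound k n fun _ => 1)) := by
  obtain ⟨k, rfl⟩ := Nat.exists_eq_succ_of_ne_zero (by omega : k ≠ 0)
  refine ⟨fun f hf α Q _ A hQ hA => ?_, fun hn => ?_⟩
  · have h := hasDFA_catenation n f A hQ (fun i => ?_) fun i => (hf i).2
    · obtain ⟨τ, hτ, M, hc, hM⟩ := h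
      refine ⟨τ, hτ, M, ?_, hM⟩
      have := one_le_catBound n f fun i => (hf i).2
      rw [hc, Int.toNat_of_nonneg (by omega)]
    · rw [card_finals, hA]
  · obtain ⟨α, hα, hα', Q, hQ, A, hc, hA, hsc, hlow⟩ := exists_witness n hn
    have hdfa : ∀ i, HasDFA (A i).accepts (n (i + 1)) := fun i =>
      ⟨Q i, hQ i, A i, hc i, rfl⟩
    have hmax := stateComplexity_catenation_le n hn _ hdfa
    have heq : (stateComplexity (catenation fun i => (A i).accepts) : ℤ) =
        catBound (k + 1) n fun _ => 1 := by
      -- The lower bound applies to the infimum because it is attained: the upper bound makes the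
      -- set of automaton sizes nonempty.
      exact le_antisymm hmax (hlow _ (Nat.sInf_mem (s := {m | HasDFA _ m})
        ⟨_, hasDFA_catenation n (fun _ => 1) A hc (fun i => by rw [card_finals, hA]) fun i => hn i⟩))
    refine ⟨⟨α, hα, hα', Q, hQ, A, hc, hA, hlow⟩, ⟨?_, ?_⟩, ?_, ?_⟩
    · exact ⟨α, hα, hα', _, hdfa, heq⟩
    · rintro _ ⟨α, _, _, L, hL, rfl⟩
      exact stateComplexity_catenation_le n hn L hL
    · exact ⟨α, hα, hα', _, hsc, heq⟩
    · rintro _ ⟨α, _, _, L, hL, rfl⟩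
      exact stateComplexity_catenation_le n hn L fun i =>
        hasDFA_of_stateComplexity (hL i) (by have := hn i; omega)
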